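/- Burnside's Theorem. Let $p$ and $q$ be distinct prime numbers, let $a, b \ge 0$ be integers, and let $G$ be a finite group of order $p^a q^b$. Then $G$ is solvable, i.e. its derived series reaches the trivial subgroup after finitely many steps. -/

import Mathlib

/-! By induction on the order, a proper nontrivial normal subgroup reduces the claim to that
subgroup and its quotient. If `G` is simple with trivial center, a nontrivial central element `g` of
a Sylow `q`-subgroup has a class of size `p ^ k`, and characters exclude this. For an irreducible χ
of degree prime to `p`, χ(g)/χ(1) is an algebraic integer and an average of roots of unity, so it is
0 or `g` acts as a scalar. For nontrivial χ, a scalar action would make `g` central, since χ is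
faithful. Hence 1 + ∑ χ(1)χ(g) = 0, over nontrivial χ, makes -1/p an algebraic integer. -/

/-! ### Averages of roots of unity -/

/-- An algebraic integer in `ℂ` that is an average of complex numbers of finite order is zero or
lies on the unit circle. -/
theorem eq_zero_or_one_le_norm_of_average {n : ℕ} (hn : 0 < n) (s : Multiset ℂ)
    (hs : ∀ z ∈ s, z ^ n = 1) (α : ℂ) (hα : (s.card : ℂ) * α = s.sum) (hcard : 0 < s.card)
    (hint : IsIntegral ℤ α) : α = 0 ∨ 1 ≤ ‖α‖ := by
  classical
  by_contra! h
  obtain ⟨h0, h1⟩ := h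
  have hints : ∀ z ∈ (s.toFinset : Set ℂ), IsIntegral ℚ z := fun z hz => by
    refine IsIntegral.of_pow hn ?_
    rw [hs z (by simpa using hz)]
    exact isIntegral_one
  let K := IntermediateField.adjoin ℚ (s.toFinset : Set ℂ)
  have : FiniteDimensional ℚ K := IntermediateField.finiteDimensional_adjoin hints
  have hmem : ∀ z ∈ s, z ∈ K := fun z hz =>
    IntermediateField.subset_adjoin _ _ (by simpa using hz)
  have hc : (s.card : ℂ) ≠ 0 := by exact_mod_cast hcard.ne'
  have hαK : α ∈ K := by
    rw [eq_div_of_mul_eq hc ((mul_comm _ _).trans hα)]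
    exact div_mem (multiset_sum_mem _ hmem) (natCast_mem _ _)
  let a : K := ⟨α, hαK⟩
  have haint : IsIntegral ℤ a :=
    (isIntegral_algHom_iff (K.val.restrictScalars ℤ) (RingHom.injective _)).1 hint
  -- An embedding sends roots of unity to roots of unity, so every conjugate of the average is again
  -- such an average.
  have hσ : ∀ σ : K →ₐ[ℚ] ℂ, ‖σ a‖ ≤ 1 := by
    intro σ
    let t : Multiset K := s.attach.map fun z => ⟨z.1, hmem z.1 z.2⟩
    have htc : t.card = s.card := by simp [t]
    have ht : (s.card : K) * a = t.sum := by
      apply Subtype.ext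
      have : ((t.sum : K) : ℂ) = s.sum := by
        rw [← IntermediateField.coe_val, map_multiset_sum, Multiset.map_map]
        exact congrArg Multiset.sum (Multiset.attach_map_val s)
      rw [this, ← hα]
      simp [a]
    have ht1 : ∀ w ∈ t, ‖σ w‖ = 1 := by
      intro w hw
      obtain ⟨z, -, rfl⟩ := Multiset.mem_map.1 hw
      refine Complex.norm_eq_one_of_pow_eq_one (n := n) ?_ hn.ne'
      rw [← map_pow, ← map_one σ]
      exact congrArg σ (Subtype.ext (hs _ z.2))
    have hle : ‖σ t.sum‖ ≤ s.card := by
      rw [map_multiset_sum]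
      refine (norm_multiset_sum_le _).trans ?_
      rw [Multiset.map_map, Multiset.map_congr rfl (g := fun _ => (1 : ℝ)) (by simpa using ht1)]
      simp [htc]
    rw [← ht, map_mul, map_natCast, norm_mul, Complex.norm_natCast] at hle
    have : (0 : ℝ) < s.card := by exact_mod_cast hcard
    nlinarith
  -- The norm is the product of the conjugates: all have modulus at most 1, and the one at the
  -- inclusion is smaller. Being a rational integer, it vanishes.
  have hnorm : ‖algebraMap ℚ ℂ (Algebra.norm ℚ a)‖ < 1 := by
    rw [Algebra.norm_eq_prod_embeddings, norm_prod]
    refine (Finset.mul_prod_erase _ (fun σ : K →ₐ[ℚ] ℂ => ‖σ a‖)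
      (@Finset.mem_univ _ _ K.val)).symm.trans_lt ?_
    calc _ ≤ ‖α‖ * 1 := by
          gcongr
          · exact le_rfl
          · exact Finset.prod_le_one (fun _ _ => norm_nonneg _) fun σ _ => hσ σ
      _ < 1 := by simpa using h1
  obtain ⟨m, hm⟩ := IsIntegrallyClosed.isIntegral_iff.1 (Algebra.isIntegral_norm ℚ haint)
  rw [← hm] at hnorm
  have hm0 : m = 0 := by
    rw [← Int.abs_lt_one_iff]
    simpa [← Int.cast_abs, ← Int.cast_one (R := ℝ), -Int.cast_one] using hnorm
  rw [hm0, map_zero, eq_comm, Algebra.norm_eq_zero_iff] at hm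
  exact h0 (congrArg Subtype.val hm)

/-- If the average of complex numbers on the unit circle has norm at least one, they are all equal
to that average. -/
theorem eq_of_average_norm_one (s : Multiset ℂ) (hs : ∀ z ∈ s, ‖z‖ = 1) (α : ℂ)
    (hα : (s.card : ℂ) * α = s.sum) (h1 : 1 ≤ ‖α‖) : ∀ z ∈ s, z = α := by
  -- A variance identity: its left side is nonnegative, its right side nonpositive once `1 ≤ ‖α‖`.
  have hsum : (s.map fun z => ‖z - α‖ ^ 2).sum = s.card * (1 - ‖α‖ ^ 2) := by
    have h2 : ∀ z ∈ s, ‖z - α‖ ^ 2 = 1 + ‖α‖ ^ 2 - 2 * (z * (starRingEnd ℂ) α).re := fun z hz => by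
      rw [← Complex.normSq_eq_norm_sq, Complex.normSq_sub, Complex.normSq_eq_norm_sq, hs z hz,
        Complex.normSq_eq_norm_sq]
      ring
    have h3 : (s.map fun z => (z * (starRingEnd ℂ) α).re).sum = s.card * ‖α‖ ^ 2 := by
      have : (s.map fun z => (z * (starRingEnd ℂ) α).re).sum
          = (s.sum * (starRingEnd ℂ) α).re := by
        clear hs hα h2
        induction s using Multiset.induction with
        | empty => simp
        | cons z s ih => rw [Multiset.map_cons, Multiset.sum_cons, ih, Multiset.sum_cons, add_mul,
            Complex.add_re]
      rw [this, ← hα, mul_assoc, Complex.mul_conj, Complex.normSq_eq_norm_sq]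
      norm_cast
    rw [Multiset.map_congr rfl h2, Multiset.sum_map_sub, Multiset.sum_map_mul_left, h3]
    simp
    ring
  intro z hz
  have hle : ‖z - α‖ ^ 2 ≤ (s.map fun z => ‖z - α‖ ^ 2).sum :=
    Multiset.single_le_sum (by simp) _ (Multiset.mem_map_of_mem _ hz)
  have : (s.card : ℝ) * (1 - ‖α‖ ^ 2) ≤ 0 :=
    mul_nonpos_of_nonneg_of_nonpos (by positivity) (by nlinarith)
  have h0 : ‖z - α‖ ^ 2 = 0 := le_antisymm (by linarith) (by positivity)
  exact sub_eq_zero.1 (by simpa using h0)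

/-! ### Matrices of finite order and class sums -/

open Polynomial in
/-- A matrix of finite order all of whose eigenvalues are equal is scalar. -/
theorem Matrix.eq_scalar_of_pow_eq_one {d : ℕ} {n : ℕ} (hn : 0 < n)
    (M : Matrix (Fin d) (Fin d) ℂ) (hM : M ^ n = 1) (α : ℂ)
    (hα : ∀ z ∈ M.charpoly.roots, z = α) : M = Matrix.scalar (Fin d) α := by
  have hsep : Squarefree (X ^ n - 1 : ℂ[X]) :=
    (Polynomial.separable_X_pow_sub_C (F := ℂ) 1 (by exact_mod_cast hn.ne')
      one_ne_zero).squarefree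
  have hsq : Squarefree (minpoly ℂ M) := by
    refine hsep.squarefree_of_dvd (minpoly.dvd _ _ ?_)
    simp [hM]
  have hchar : M.charpoly = (X - C α) ^ M.charpoly.roots.card := by
    conv_lhs => rw [(IsAlgClosed.splits M.charpoly).eq_prod_roots_of_monic M.charpoly_monic,
      Multiset.eq_replicate_card.2 hα, Multiset.map_replicate, Multiset.prod_replicate]
  have hdvd : minpoly ℂ M ∣ X - C α := by
    have h := Matrix.minpoly_dvd_charpoly M
    rw [hchar] at h
    exact hsq.isRadical _ _ h
  have := Polynomial.aeval_eq_zero_of_dvd_aeval_eq_zero hdvd (minpoly.aeval ℂ M)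
  rw [map_sub, aeval_X, aeval_C, sub_eq_zero] at this
  exact this

/-- A root of the characteristic polynomial of a matrix of finite order is a root of unity. -/
theorem Matrix.pow_eq_one_of_mem_roots_charpoly {d : ℕ} {n : ℕ}
    (M : Matrix (Fin d) (Fin d) ℂ) (hM : M ^ n = 1) {z : ℂ} (hz : z ∈ M.charpoly.roots) :
    z ^ n = 1 := by
  have h1 : z ∈ spectrum ℂ M := by
    rw [Matrix.mem_spectrum_iff_isRoot_charpoly]
    exact Polynomial.isRoot_of_mem_roots hz
  have h2 := spectrum.pow_mem_pow M n h1
  rw [hM] at h2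
  by_cases hd : Nontrivial (Matrix (Fin d) (Fin d) ℂ)
  · simpa [spectrum.one_eq] using h2
  · rw [not_nontrivial_iff_subsingleton] at hd
    simp [spectrum.of_subsingleton] at h2

/-- Let `ρ` be a matrix representation with scalar commutant and let the size of the conjugacy
class of `g` be coprime to the degree. Then `ρ g` has trace zero or is scalar. -/
theorem trace_eq_zero_or_scalar_of_coprime {G : Type*} [Group G] [Fintype G] [DecidableEq G]
    {d : ℕ} (ρ : G →* Matrix (Fin d) (Fin d) ℂ) (hd : 0 < d)
    (hschur : ∀ M, (∀ g, Commute (ρ g) M) → ∃ c, Matrix.scalar (Fin d) c = M)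
    (g : G) (C : Finset G) (hC : ∀ h, h ∈ C ↔ IsConj g h) (hcop : C.card.Coprime d) :
    (ρ g).trace = 0 ∨ ∃ c, ρ g = Matrix.scalar (Fin d) c := by
  set φ := MonoidAlgebra.lift ℤ (Matrix (Fin d) (Fin d) ℂ) G ρ
  let z : MonoidAlgebra ℤ G := ∑ h ∈ C, MonoidAlgebra.single h 1
  have hφz : φ z = ∑ h ∈ C, ρ h := by simp [z, φ]
  have hcomm : ∀ x, Commute (ρ x) (φ z) := by
    intro x
    rw [hφz, Commute, SemiconjBy, Finset.mul_sum, Finset.sum_mul]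
    refine Finset.sum_equiv (MulAut.conj x).toEquiv (fun h => ?_) fun h _ => ?_
    · rw [hC, hC]
      exact ⟨fun hh => hh.trans (isConj_iff.2 ⟨x, rfl⟩),
        fun hh => hh.trans (isConj_iff.2 ⟨x, rfl⟩ : IsConj h _).symm⟩
    · simp [← map_mul]
  -- The central character value |C|χ(g)/χ(1), integral because the class sum is integral in the
  -- group ring over `ℤ`.
  obtain ⟨w, hw⟩ := hschur _ hcomm
  have hintz : IsIntegral ℤ z := IsIntegral.of_finite ℤ z
  have hintw : IsIntegral ℤ w := by
    have : NeZero d := ⟨hd.ne'⟩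
    refine (isIntegral_algHom_iff
      ((Algebra.ofId ℂ (Matrix (Fin d) (Fin d) ℂ)).restrictScalars ℤ) ?_ (x := w)).1 ?_
    · exact (algebraMap ℂ (Matrix (Fin d) (Fin d) ℂ)).injective
    · have := hintz.map φ
      rw [← hw] at this
      exact this
  have hN : 0 < Fintype.card G := Fintype.card_pos
  have hpow : ∀ h, (ρ h) ^ Fintype.card G = 1 := fun h => by
    rw [← map_pow, pow_card_eq_one, map_one]
  have hroots : ∀ z ∈ (ρ g).charpoly.roots, z ^ Fintype.card G = 1 := fun z hz =>
    Matrix.pow_eq_one_of_mem_roots_charpoly _ (hpow g) hz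
  have hcardroots : (ρ g).charpoly.roots.card = d := by
    rw [← (IsAlgClosed.splits (ρ g).charpoly).natDegree_eq_card_roots,
      Matrix.charpoly_natDegree_eq_dim, Fintype.card_fin]
  have htrace : (ρ g).trace = (ρ g).charpoly.roots.sum := Matrix.trace_eq_sum_roots_charpoly _
  have hinttr : IsIntegral ℤ (ρ g).trace := by
    rw [htrace]
    exact IsIntegral.multiset_sum fun z hz => IsIntegral.of_pow hN (hroots z hz ▸ isIntegral_one)
  have hwtr : (d : ℂ) * w = C.card * (ρ g).trace := by
    have h1 := congrArg Matrix.trace hw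
    rw [hφz, Matrix.trace_sum, Finset.sum_congr rfl (g := fun _ => (ρ g).trace)] at h1
    · simpa [mul_comm] using h1
    · intro h hh
      obtain ⟨c, rfl⟩ := isConj_iff.1 ((hC h).1 hh)
      rw [map_mul, Matrix.trace_mul_comm, ← map_mul]
      simp
  have hd0 : (d : ℂ) ≠ 0 := by exact_mod_cast hd.ne'
  obtain ⟨α, hαd⟩ : ∃ α : ℂ, d * α = (ρ g).trace :=
    ⟨(ρ g).trace / d, mul_div_cancel₀ _ hd0⟩
  have hαint : IsIntegral ℤ α := by
    -- Bézout writes χ(g)/χ(1) as an integer combination of `w` and χ(g).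
    have hb := Nat.gcd_eq_gcd_ab C.card d
    rw [hcop.gcd_eq_one] at hb
    have hb' : (1 : ℂ) = C.card * (C.card.gcdA d : ℂ) + d * (C.card.gcdB d : ℂ) := by
      exact_mod_cast hb
    have : α = (C.card.gcdA d : ℂ) * w + (C.card.gcdB d : ℂ) * (ρ g).trace := by
      apply mul_left_cancel₀ hd0
      linear_combination hαd + (ρ g).trace * hb' - (C.card.gcdA d : ℂ) * hwtr
    rw [this]
    exact ((isIntegral_algebraMap (x := C.card.gcdA d)).mul hintw).add
      ((isIntegral_algebraMap (x := C.card.gcdB d)).mul hinttr)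
  have havg : ((ρ g).charpoly.roots.card : ℂ) * α = (ρ g).charpoly.roots.sum := by
    rw [hcardroots, hαd, htrace]
  rcases eq_zero_or_one_le_norm_of_average hN _ hroots α havg (by rwa [hcardroots]) hαint with h | h
  · left
    rw [← hαd, h, mul_zero]
  · right
    refine ⟨α, Matrix.eq_scalar_of_pow_eq_one hN _ (hpow g) α ?_⟩
    exact eq_of_average_norm_one _
      (fun z hz => Complex.norm_eq_one_of_pow_eq_one (hroots z hz) hN.ne') α havg h

/-! ### The regular character and classes of prime power size -/

/-- The trace of left multiplication on a product of matrix algebras. -/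
theorem trace_mulLeft_pi_matrix {n : ℕ} (d : Fin n → ℕ)
    (x : Π i, Matrix (Fin (d i)) (Fin (d i)) ℂ) :
    LinearMap.trace ℂ _ (LinearMap.mulLeft ℂ x) = ∑ i, (d i : ℂ) * (x i).trace := by
  classical
  rw [LinearMap.trace_eq_matrix_trace ℂ
    (Pi.basis fun i => Matrix.stdBasis ℂ (Fin (d i)) (Fin (d i))), Matrix.trace,
    Fintype.sum_sigma]
  refine Finset.sum_congr rfl fun i _ => ?_
  rw [Fintype.sum_prod_type]
  have key : ∀ j k, (LinearMap.toMatrix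
      (Pi.basis fun i => Matrix.stdBasis ℂ (Fin (d i)) (Fin (d i)))
      (Pi.basis fun i => Matrix.stdBasis ℂ (Fin (d i)) (Fin (d i)))
      (LinearMap.mulLeft ℂ x)).diag ⟨i, j, k⟩ = x i j j := by
    intro j k
    rw [Matrix.diag_apply, LinearMap.toMatrix_apply, Pi.basis_repr, Pi.basis_apply,
      LinearMap.mulLeft_apply, Pi.mul_apply, Pi.single_eq_same, Matrix.stdBasis_eq_single]
    simp [Matrix.stdBasis]
  simp only [key]
  simp [Matrix.trace, Finset.mul_sum]

/-- The trace of left multiplication by a group element on the group algebra. -/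
theorem MonoidAlgebra.trace_mulLeft_of {G : Type*} [Group G] [Fintype G] [DecidableEq G] (g : G) :
    LinearMap.trace ℂ _ (LinearMap.mulLeft ℂ (MonoidAlgebra.of ℂ G g))
      = if g = 1 then (Fintype.card G : ℂ) else 0 := by
  rw [LinearMap.trace_eq_matrix_trace ℂ (MonoidAlgebra.basis G ℂ), Matrix.trace]
  have key : ∀ h, (LinearMap.toMatrix (MonoidAlgebra.basis G ℂ) (MonoidAlgebra.basis G ℂ)
      (LinearMap.mulLeft ℂ (MonoidAlgebra.of ℂ G g))).diag h = if g = 1 then 1 else 0 := by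
    intro h
    rw [Matrix.diag_apply, LinearMap.toMatrix_apply, MonoidAlgebra.basis_apply,
      LinearMap.mulLeft_apply, MonoidAlgebra.of_apply, MonoidAlgebra.single_mul_single, mul_one]
    change (MonoidAlgebra.single (g * h) (1 : ℂ)).coeff h = _
    simp [Finsupp.single_apply]
  simp only [key]
  simp

/-- A matrix commuting with the image of a group spanning the full matrix algebra is scalar. -/
theorem Matrix.exists_scalar_of_commute_lift {G : Type*} [Group G] {d : ℕ}
    (f : MonoidAlgebra ℂ G →ₐ[ℂ] Matrix (Fin d) (Fin d) ℂ) (hf : Function.Surjective f)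
    (M : Matrix (Fin d) (Fin d) ℂ) (hM : ∀ g, Commute (f (MonoidAlgebra.of ℂ G g)) M) :
    ∃ c, Matrix.scalar (Fin d) c = M := by
  refine Matrix.mem_range_scalar_iff_commute_single'.2 fun i j => ?_
  suffices key : ∀ x, Commute (f x) M by
    obtain ⟨x, hx⟩ := hf (Matrix.single i j 1)
    exact hx ▸ key x
  intro x
  induction x using MonoidAlgebra.induction_on with
  | of g => exact hM g
  | add x y hx hy => exact map_add f x y ▸ hx.add_left hy
  | smul r x hx => exact map_smul f r x ▸ hx.smul_left r

/-- A finite simple group with trivial center has no nontrivial conjugacy class of prime power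
size. -/
theorem IsSimpleGroup.false_of_card_conjClass_eq_prime_pow {G : Type*} [Group G] [Fintype G]
    [DecidableEq G] [IsSimpleGroup G] (hcenter : Subgroup.center G = ⊥) {p k : ℕ} (hp : p.Prime)
    (g : G) (hg : g ≠ 1) (C : Finset G) (hC : ∀ h, h ∈ C ↔ IsConj g h) (hcard : C.card = p ^ k) :
    False := by
  classical
  have : NeZero (Nat.card G : ℂ) := ⟨by exact_mod_cast Nat.card_pos.ne'⟩
  have : FiniteDimensional ℂ (MonoidAlgebra ℂ G) := .of_basis (MonoidAlgebra.basis G ℂ)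
  obtain ⟨n, d, hd, ⟨e⟩⟩ :=
    IsSemisimpleRing.exists_algEquiv_pi_matrix_of_isAlgClosed ℂ (MonoidAlgebra ℂ G)
  let f : ∀ i, MonoidAlgebra ℂ G →ₐ[ℂ] Matrix (Fin (d i)) (Fin (d i)) ℂ := fun i =>
    (Pi.evalAlgHom ℂ (fun i => Matrix (Fin (d i)) (Fin (d i)) ℂ) i).comp e.toAlgHom
  have hf : ∀ i, Function.Surjective (f i) := fun i =>
    (Function.surjective_eval i).comp e.surjective
  let ρ : ∀ i, G →* Matrix (Fin (d i)) (Fin (d i)) ℂ := fun i =>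
    (f i : MonoidAlgebra ℂ G →* _).comp (MonoidAlgebra.of ℂ G)
  have hd0 : ∀ i, 0 < d i := fun i => Nat.pos_of_ne_zero (hd i).ne
  have hschur : ∀ i M, (∀ g, Commute (ρ i g) M) → ∃ c, Matrix.scalar (Fin (d i)) c = M :=
    fun i M hM => Matrix.exists_scalar_of_commute_lift (f i) (hf i) M hM
  -- The regular character, computed in the group algebra and in its Wedderburn decomposition.
  have htr : ∀ h, ∑ i, (d i : ℂ) * (ρ i h).trace = if h = 1 then (Fintype.card G : ℂ) else 0 := by
    intro h
    rw [← MonoidAlgebra.trace_mulLeft_of, ← LinearMap.trace_conj' _ e.toLinearEquiv]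
    have : e.toLinearEquiv.conj (LinearMap.mulLeft ℂ (MonoidAlgebra.of ℂ G h))
        = LinearMap.mulLeft ℂ (e (MonoidAlgebra.of ℂ G h)) := by
      refine LinearMap.ext fun x => ?_
      change e (MonoidAlgebra.of ℂ G h * e.symm x) = e (MonoidAlgebra.of ℂ G h) * x
      rw [map_mul, e.apply_symm_apply]
    rw [this, trace_mulLeft_pi_matrix]
    rfl
  let T : Finset (Fin n) := {i | ρ i = 1}
  have havg : ∀ i ∉ T, ∑ h, ρ i h = 0 := by
    intro i hi
    have hmul : ∀ x, ρ i x * ∑ h, ρ i h = ∑ h, ρ i h := fun x => by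
      rw [Finset.mul_sum, ← Equiv.sum_comp (Equiv.mulLeft x) (fun h => ρ i h)]
      simp
    have hmul' : ∀ x, (∑ h, ρ i h) * ρ i x = ∑ h, ρ i h := fun x => by
      rw [Finset.sum_mul, ← Equiv.sum_comp (Equiv.mulRight x) (fun h => ρ i h)]
      simp
    obtain ⟨c, hc⟩ := hschur i _ fun x => (hmul x).trans (hmul' x).symm
    rw [← hc]
    by_cases hc0 : c = 0
    · simp [hc0]
    · refine absurd ?_ hi
      simp only [T, Finset.mem_filter_univ]
      ext1 x
      have h := hmul x
      rw [← hc, Matrix.scalar_apply, ← Matrix.smul_one_eq_diagonal, mul_smul_comm, mul_one] at h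
      exact smul_right_injective _ hc0 h
  have hT : ∀ i ∈ T, ∀ h, (ρ i h).trace = d i := by
    intro i hi h
    simp only [T, Finset.mem_filter_univ] at hi
    simp [hi]
  -- Summing the regular character over the group leaves only the trivial blocks, so there is no
  -- need to show that exactly one block is trivial.
  have hT1 : ∑ i ∈ T, (d i : ℂ) * d i = 1 := by
    have hN : (Fintype.card G : ℂ) ≠ 0 := by exact_mod_cast Fintype.card_ne_zero
    have h1 : ∑ h, ∑ i, (d i : ℂ) * (ρ i h).trace = Fintype.card G := by
      simp [htr]
    rw [Finset.sum_comm, ← Finset.sum_add_sum_compl T,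
      Finset.sum_eq_zero (s := Tᶜ), add_zero,
      Finset.sum_congr rfl (g := fun i => (Fintype.card G : ℂ) * ((d i : ℂ) * d i)),
      ← Finset.mul_sum] at h1
    · exact mul_left_cancel₀ hN (h1.trans (mul_one _).symm)
    · intro i hi
      simp [hT i hi]
    · intro i hi
      rw [← Finset.mul_sum, ← Matrix.trace_sum, havg i (Finset.mem_compl.1 hi)]
      simp
  -- Each nontrivial block contributes `p` times an algebraic integer: either `p` divides the degree
  -- or the trace vanishes.
  have hTc : ∀ i ∉ T, ∃ y : ℂ, IsIntegral ℤ y ∧ (d i : ℂ) * (ρ i g).trace = p * y := by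
    intro i hi
    have hint : IsIntegral ℤ (ρ i g).trace := by
      rw [Matrix.trace_eq_sum_roots_charpoly]
      refine IsIntegral.multiset_sum fun z hz => IsIntegral.of_pow (Fintype.card_pos (α := G)) ?_
      rw [Matrix.pow_eq_one_of_mem_roots_charpoly (ρ i g) ?_ hz]
      · exact isIntegral_one
      · rw [← map_pow, pow_card_eq_one, map_one]
    by_cases hpd : p ∣ d i
    · obtain ⟨m, hm⟩ := hpd
      refine ⟨m * (ρ i g).trace, (isIntegral_algebraMap (x := (m : ℤ))).mul hint, ?_⟩
      rw [← mul_assoc]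
      exact congrArg (· * (ρ i g).trace) (by exact_mod_cast hm)
    · have hcop : C.card.Coprime (d i) := by
        rw [hcard]
        exact Nat.Coprime.pow_left _ ((Nat.Prime.coprime_iff_not_dvd hp).2 hpd)
      rcases trace_eq_zero_or_scalar_of_coprime (ρ i) (hd0 i) (hschur i) g C hC hcop with h | h
      · exact ⟨0, isIntegral_zero, by simp [h]⟩
      · obtain ⟨c, hc⟩ := h
        have hinj : Function.Injective (ρ i) := by
          rw [← MonoidHom.ker_eq_bot_iff]
          refine (IsSimpleGroup.eq_bot_or_eq_top_of_normal _ inferInstance).resolve_right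
            fun h => hi ?_
          simp only [T, Finset.mem_filter_univ]
          exact MonoidHom.ker_eq_top_iff.1 h
        have : g ∈ Subgroup.center G := by
          rw [Subgroup.mem_center_iff]
          intro x
          apply hinj
          rw [map_mul, map_mul, hc]
          exact (Matrix.scalar_commute c (fun _ => mul_comm _ _) _).symm
        rw [hcenter] at this
        exact absurd (Subgroup.mem_bot.1 this) hg
  have hg0 := htr g
  rw [if_neg hg, ← Finset.sum_add_sum_compl T,
    Finset.sum_congr rfl (fun i hi => by rw [hT i hi g]), hT1] at hg0
  obtain ⟨y, hy, hyp⟩ : ∃ y : ℂ, IsIntegral ℤ y ∧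
      ∑ i ∈ Tᶜ, (d i : ℂ) * (ρ i g).trace = p * y := by
    choose! y hy hyp using hTc
    refine ⟨∑ i ∈ Tᶜ, y i, IsIntegral.sum _ fun i hi => hy i (Finset.mem_compl.1 hi), ?_⟩
    rw [Finset.mul_sum]
    exact Finset.sum_congr rfl fun i hi => hyp i (Finset.mem_compl.1 hi)
  rw [hyp] at hg0
  have hp0 : (p : ℂ) ≠ 0 := by exact_mod_cast hp.ne_zero
  have hyq : y = algebraMap ℚ ℂ (-1 / p) := by
    rw [map_div₀, map_neg, map_one, map_natCast, eq_div_iff hp0]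
    linear_combination hg0
  rw [hyq, isIntegral_algebraMap_iff (algebraMap ℚ ℂ).injective,
    IsIntegrallyClosed.isIntegral_iff] at hy
  obtain ⟨m, hm⟩ := hy
  have hp0' : (p : ℚ) ≠ 0 := by exact_mod_cast hp.ne_zero
  have : (m : ℚ) * p = -1 := by
    rw [eq_div_iff hp0'] at hm
    exact hm
  have h1 : (p : ℤ) ∣ 1 := ⟨-m, by
    have : m * p = -1 := by exact_mod_cast this
    linarith⟩
  exact hp.one_lt.ne' (by exact_mod_cast Int.eq_one_of_dvd_one (by positivity) h1)

/-! ### Sylow subgroups and induction on the order -/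

/-- A finite simple group of order `p ^ a * q ^ b` with `b ≠ 0` is solvable. -/
theorem IsSimpleGroup.isSolvable_of_card_eq_prime_pow_mul_prime_pow {G : Type*} [Group G]
    [Finite G] [IsSimpleGroup G] {p q : ℕ} (hp : p.Prime) (hq : q.Prime) (hpq : p ≠ q) {a b : ℕ}
    (hb : b ≠ 0) (hG : Nat.card G = p ^ a * q ^ b) : Group.IsSolvable G := by
  classical
  have := Fintype.ofFinite G
  have : Fact q.Prime := ⟨hq⟩
  rcases IsSimpleGroup.eq_bot_or_eq_top_of_normal (Subgroup.center G) inferInstance with hc | hc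
  swap
  · rw [← IsSimpleGroup.comm_iff_isSolvable]
    intro x y
    have : y ∈ Subgroup.center G := hc ▸ Subgroup.mem_top y
    exact Subgroup.mem_center_iff.1 this x
  exfalso
  let P : Sylow q G := default
  have hP : Nat.card P = q ^ b := by
    have hmul : (Nat.card G).factorization q = b := by
      rw [hG, Nat.factorization_mul (pow_ne_zero _ hp.ne_zero) (pow_ne_zero _ hq.ne_zero),
        hp.factorization_pow, hq.factorization_pow]
      simp [hpq]
    rw [P.card_eq_multiplicity, hmul]
  have hPnt : Nontrivial P := by
    rw [← Finite.one_lt_card_iff_nontrivial, hP]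
    exact Nat.one_lt_pow hb hq.one_lt
  have := P.isPGroup'.center_nontrivial
  obtain ⟨⟨x, hx⟩, hx1⟩ := exists_ne (1 : Subgroup.center P)
  let g : G := x
  have hg : g ≠ 1 := fun h => hx1 (Subtype.ext (Subtype.ext h))
  -- Since the centralizer contains the whole Sylow `q`-subgroup, the class size divides `p ^ a`.
  have hle : (P : Subgroup G) ≤ Subgroup.centralizer {g} := by
    intro y hy
    rw [Subgroup.mem_centralizer_singleton_iff]
    exact congrArg Subtype.val (Subgroup.mem_center_iff.1 hx ⟨y, hy⟩)
  let C : Finset G := {h | IsConj g h}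
  have hC : ∀ h, h ∈ C ↔ IsConj g h := by simp [C]
  have hcard : C.card * Nat.card (Subgroup.centralizer {g}) = p ^ a * q ^ b := by
    have horb : (C : Set G) = MulAction.orbit (ConjAct G) g := by
      ext h
      rw [Finset.mem_coe, hC, ConjAct.mem_orbit_conjAct, isConj_comm]
    rw [Subgroup.nat_card_centralizer_nat_card_stabilizer, ← hG, ← Set.ncard_coe_finset, horb,
      ← MulAction.index_stabilizer, Subgroup.index_mul_card]
    rfl
  have hdvd : q ^ b ∣ Nat.card (Subgroup.centralizer {g}) := hP ▸ Subgroup.card_dvd_of_le hle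
  obtain ⟨m, hm⟩ := hdvd
  have hCdvd : C.card ∣ p ^ a := by
    refine ⟨m, Nat.eq_of_mul_eq_mul_right (pow_pos hq.pos b) ?_⟩
    rw [← hcard, hm]
    ring
  obtain ⟨k, -, hk⟩ := (Nat.dvd_prime_pow hp).1 hCdvd
  exact IsSimpleGroup.false_of_card_conjClass_eq_prime_pow hc hp g hg C hC hk

/-- A finite group of order `p ^ a * q ^ b` is solvable, by induction on a bound for its order. -/
theorem Group.isSolvable_of_card_le {p q : ℕ} (hp : p.Prime) (hq : q.Prime) (hpq : p ≠ q)
    (n : ℕ) : ∀ {G : Type*} [Group G] [Finite G] (a b : ℕ), Nat.card G ≤ n →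
      Nat.card G = p ^ a * q ^ b → Group.IsSolvable G := by
  induction n with
  | zero => intro G _ _ a b hn; exact absurd hn (Nat.card_pos.not_ge)
  | succ n ih =>
    intro G _ _ a b hn hG
    rcases subsingleton_or_nontrivial G with _ | _
    · infer_instance
    have hdvd : ∀ m, m ∣ p ^ a * q ^ b → ∃ c d, m = p ^ c * q ^ d := by
      intro m hm
      obtain ⟨u, v, hu, hv, rfl⟩ := exists_dvd_and_dvd_of_dvd_mul hm
      obtain ⟨c, -, rfl⟩ := (Nat.dvd_prime_pow hp).1 hu
      obtain ⟨d, -, rfl⟩ := (Nat.dvd_prime_pow hq).1 hv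
      exact ⟨c, d, rfl⟩
    by_cases hs : IsSimpleGroup G
    · by_cases hb : b = 0
      -- Without a factor `q`, the roles of the two primes are exchanged.
      · have ha : a ≠ 0 := by
          rintro rfl
          rw [hb, pow_zero, pow_zero, one_mul] at hG
          exact (Finite.one_lt_card (α := G)).ne' hG
        exact IsSimpleGroup.isSolvable_of_card_eq_prime_pow_mul_prime_pow hq hp hpq.symm ha
          (hG.trans (mul_comm _ _))
      · exact IsSimpleGroup.isSolvable_of_card_eq_prime_pow_mul_prime_pow hp hq hpq hb hG
    · obtain ⟨H, hH, hbot, htop⟩ : ∃ H : Subgroup G, H.Normal ∧ H ≠ ⊥ ∧ H ≠ ⊤ := by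
        by_contra! h
        exact hs ⟨fun H hH => or_iff_not_imp_left.2 (h H hH)⟩
      have hmul := H.card_mul_index
      have hH1 : 1 < Nat.card H := (Subgroup.one_lt_card_iff_ne_bot H).2 hbot
      have hi1 : 1 < H.index := by
        have := Subgroup.index_eq_one.not.2 htop
        have := H.index_ne_zero_of_finite
        omega
      rw [Group.isSolvable_iff_subgroup_quotient H]
      constructor
      · obtain ⟨c, d, hcd⟩ := hdvd _ (hG ▸ Subgroup.card_subgroup_dvd_card H)
        exact ih c d (by nlinarith) hcd
      · obtain ⟨c, d, hcd⟩ := hdvd _ (hG ▸ Subgroup.index_dvd_card H)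
        exact ih c d (show H.index ≤ n by nlinarith) hcd

theorem mainTheorem1 {G : Type*} [Group G] [Finite G] (p q : ℕ) (hp : p.Prime) (hq : q.Prime)
    (hpq : p ≠ q) (a b : ℕ) (hG : Nat.card G = p ^ a * q ^ b) : Group.IsSolvable G :=
  Group.isSolvable_of_card_le hp hq hpq _ a b le_rfl hG
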